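/- Let $\mathbb{F}_q$ be a finite field. For a matrix $\mathbf v\in\mathbb{F}_q^{t\times n}$, let $\mathrm{wt}^{(t)}(\mathbf v)$ be the number of nonzero columns of $\mathbf v$ (equivalently, the size of the union of the supports of its rows), and let $d^{(t)}(\mathbf v,\mathbf u)=\mathrm{wt}^{(t)}(\mathbf v-\mathbf u)$. For a linear code $C\subseteq\mathbb{F}_q^n$, the $t$-th generalized covering radius $R_t(C)$ is the least integer $\rho\ge 0$ such that every $\mathbf v\in\mathbb{F}_q^{t\times n}$ satisfies $d^{(t)}(\mathbf v,\mathbf c)\le \rho$ for some $\mathbf c\in\mathbb{F}_q^{t\times n}$ all of whose rows belong to $C$. For $0\le r\le m$, the binary Reed–Muller code $\mathrm{RM}(r,m)\subseteq\mathbb{F}_2^{2^m}$ is defined recursively by $\mathrm{RM}(0,m)=\{\overline 0,\overline 1\}$, $\mathrm{RM}(m,m)=\mathbb{F}_2^{2^m}$, and $\mathrm{RM}(r,m)=\{(\overline u,\overline u+\overline v) : \overline u\in\mathrm{RM}(r,m-1),\ \overline v\in\mathrm{RM}(r-1,m-1)\}$ for $1\le r\le m-1$. Write $R_t(r,m)=R_t(\mathrm{RM}(r,m))$.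 **Lemma.** For all $m,t\in\mathbb{N}$ (the value $t=0$ is allowed) and all integers $1\le r\le m$, \[ R_t(r,m)\;\le\;\left(1-\frac{1}{2^t}\right)2^m-\frac{\sqrt{2^t-1}}{2^t}\binom{m}{r}. \] -/

import Mathlib

noncomputable section

namespace GenCovering

/-- The support of a vector: the set of its nonzero coordinates. -/
def supp {F : Type*} [Field F] [DecidableEq F] {n : ℕ} (v : Fin n → F) : Finset (Fin n) :=
  Finset.univ.filter fun j => v j ≠ 0

/-- The `t`-weight of a `t × n` matrix: the size of the union of the supports of its rows. -/
def tWeight {F : Type*} [Field F] [DecidableEq F] {t n : ℕ}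
    (v : Matrix (Fin t) (Fin n) F) : ℕ :=
  (Finset.univ.biUnion fun i : Fin t => supp (v i)).card

/-- The metric induced by the `t`-weight. -/
def tDist {F : Type*} [Field F] [DecidableEq F] {t n : ℕ}
    (v u : Matrix (Fin t) (Fin n) F) : ℕ :=
  tWeight (v - u)

/-- The ball of radius `r` centered at `v` in the metric `tDist`. -/
def tBall {F : Type*} [Field F] [DecidableEq F] {t n : ℕ} (r : ℕ)
    (v : Matrix (Fin t) (Fin n) F) : Set (Matrix (Fin t) (Fin n) F) :=
  {w | tDist v w ≤ r}

/-- The set `C^t` of `t × n` matrices all of whose rows are codewords of `C`. -/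
def codePow {F : Type*} [Field F] {n : ℕ} (t : ℕ) (C : Submodule F (Fin n → F)) :
    Set (Matrix (Fin t) (Fin n) F) :=
  {c | ∀ i, c i ∈ C}

/-- The `t`-th generalized covering radius of a linear code `C` of length `n`: the least `r` such
that the balls of radius `r` centered at `C^t` cover the space of `t × n` matrices. -/
def coveringRadius {F : Type*} [Field F] [DecidableEq F] {n : ℕ} (t : ℕ)
    (C : Submodule F (Fin n → F)) : ℕ :=
  sInf {r : ℕ | ⋃ c ∈ codePow t C, tBall r c = Set.univ}

/-- The set whose infimum is the covering radius is nonempty, so the infimum is a minimum. -/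
theorem coveringRadius_spec {F : Type*} [Field F] [DecidableEq F] {n : ℕ} (t : ℕ)
    (C : Submodule F (Fin n → F)) :
    ⋃ c ∈ codePow t C, tBall (coveringRadius t C) c = Set.univ := by
  have h : {r : ℕ | ⋃ c ∈ codePow t C, tBall r c = Set.univ}.Nonempty := by
    refine ⟨n, Set.eq_univ_of_forall fun w => ?_⟩
    refine Set.mem_iUnion₂.2 ⟨0, fun i => C.zero_mem, ?_⟩
    exact (Finset.card_le_univ _).trans (by simp)
  exact Nat.sInf_mem h

/-- The `(u, u + v)` construction applied to the codes `C₁` and `C₂` of length `n`. -/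
def uuv {F : Type*} [Field F] {n : ℕ} (C₁ C₂ : Submodule F (Fin n → F)) :
    Submodule F (Fin (n + n) → F) where
  carrier := {w | ∃ u ∈ C₁, ∃ v ∈ C₂, w = Fin.append u (u + v)}
  zero_mem' := by
    refine ⟨0, C₁.zero_mem, 0, C₂.zero_mem, ?_⟩
    ext i
    refine Fin.addCases (fun j => ?_) (fun j => ?_) i <;> simp [-Fin.natAdd_eq_addNat]
  add_mem' := by
    rintro _ _ ⟨u, hu, v, hv, rfl⟩ ⟨u', hu', v', hv', rfl⟩
    refine ⟨u + u', C₁.add_mem hu hu', v + v', C₂.add_mem hv hv', ?_⟩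
    ext i
    refine Fin.addCases (fun j => ?_) (fun j => ?_) i
    · simp
    · simp [add_add_add_comm, -Fin.natAdd_eq_addNat]
  smul_mem' := by
    rintro a _ ⟨u, hu, v, hv, rfl⟩
    refine ⟨a • u, C₁.smul_mem a hu, a • v, C₂.smul_mem a hv, ?_⟩
    ext i
    refine Fin.addCases (fun j => ?_) (fun j => ?_) i
    · simp
    · simp [mul_add, -Fin.natAdd_eq_addNat]

/-- The binary repetition code of length `n`. -/
def repetitionCode (n : ℕ) : Submodule (ZMod 2) (Fin n → ZMod 2) where
  carrier := {0, 1}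
  zero_mem' := by simp
  add_mem' := by
    rintro a b (rfl | rfl) (rfl | rfl)
    · simp
    · simp
    · simp
    · exact Or.inl (funext fun _ => (by decide : (1 : ZMod 2) + 1 = 0))
  smul_mem' := by
    rintro a b (rfl | rfl)
    · simp
    · have h : a = 0 ∨ a = 1 := by revert a; decide
      rcases h with rfl | rfl <;> simp

/-- The Reed-Muller code `RM(r, m)` of length `2 ^ m`, by the recursion
`RM(0, m) = {0, 1}`, `RM(m, m) = 𝔽₂^(2^m)` and, for `1 ≤ r ≤ m - 1`, the `(u, u + v)` construction
on `RM(r, m - 1)` and `RM(r - 1, m - 1)`. For `r > m`, which is never used, it is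
the whole space. -/
def reedMuller : (r m : ℕ) → Submodule (ZMod 2) (Fin (2 ^ m) → ZMod 2)
  | 0, m => repetitionCode (2 ^ m)
  | _ + 1, 0 => ⊤
  | r + 1, m + 1 =>
    if m ≤ r then ⊤
    else
      -- reindexes `Fin (2 ^ m + 2 ^ m)` as `Fin (2 ^ (m + 1))`, keeping the order
      (uuv (reedMuller (r + 1) m) (reedMuller r m)).comap
        (LinearEquiv.funCongrLeft (ZMod 2) (ZMod 2)
          (finCongr (by rw [pow_succ, mul_two] : 2 ^ m + 2 ^ m = 2 ^ (m + 1)))).toLinearMap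

end GenCovering

end

/-! Pascal's rule carries the induction on `m`: by `coveringRadius_uuv_le` covering radii are
subadditive under the (u, u + v) construction, and both terms of the bound add up accordingly. The
boundary cases are r = m, where the radius is 0, and r = 1. For r = 1, any three coordinates of
RM(1, m) are independent and uniform (`hasStrength_reedMuller_one`). For a uniformly random c in
C^t, the centred number of columns where c agrees with v then has the mean and variance of a sum of
independent variables, and a nonnegative third moment, so some c reaches one standard deviation
(`exists_le_of_moments`). This gives the bound with √(2^m) in place of m, which suffices unless m =
3; there the integrality of the radius closes the gap. -/

namespace GenCovering

/-! ### Covering radii and the (u, u + v) construction -/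

section Weight

variable {F : Type*} [Field F] [DecidableEq F]

theorem tWeight_eq_sum {t n : ℕ} (v : Matrix (Fin t) (Fin n) F) :
    tWeight v = ∑ j, if ∀ i, v i j = 0 then 0 else 1 := by
  have h : (Finset.univ.biUnion fun i : Fin t => supp (v i)) =
      Finset.univ.filter fun j => ¬ ∀ i, v i j = 0 := by
    ext j
    simp [supp]
  rw [tWeight, h, Finset.card_filter]
  exact Finset.sum_congr rfl fun j _ => by split_ifs <;> simp_all

theorem tWeight_sub {t n : ℕ} (c v : Matrix (Fin t) (Fin n) F) :
    tWeight (c - v) = ∑ j, if ∀ i, c i j - v i j = 0 then 0 else 1 :=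
  tWeight_eq_sum _

theorem coveringRadius_le {t n : ℕ} {C : Submodule F (Fin n → F)} {ρ : ℕ}
    (h : ∀ v : Matrix (Fin t) (Fin n) F, ∃ c ∈ codePow t C, tWeight (c - v) ≤ ρ) :
    coveringRadius t C ≤ ρ := by
  refine Nat.sInf_le (Set.eq_univ_of_forall fun v => ?_)
  obtain ⟨c, hc, hv⟩ := h v
  exact Set.mem_iUnion₂.2 ⟨c, hc, hv⟩

theorem exists_tWeight_le_coveringRadius {t n : ℕ} (C : Submodule F (Fin n → F))
    (v : Matrix (Fin t) (Fin n) F) :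
    ∃ c ∈ codePow t C, tWeight (c - v) ≤ coveringRadius t C := by
  have h : v ∈ ⋃ c ∈ codePow t C, tBall (coveringRadius t C) c := by
    rw [coveringRadius_spec]
    trivial
  obtain ⟨c, hc, hv⟩ := Set.mem_iUnion₂.1 h
  exact ⟨c, hc, hv⟩

theorem coveringRadius_top (t n : ℕ) :
    coveringRadius t (⊤ : Submodule F (Fin n → F)) = 0 := by
  refine Nat.le_zero.1 (coveringRadius_le fun v => ⟨v, fun _ => Submodule.mem_top, ?_⟩)
  simp [tWeight_eq_sum]

/-- Approximate the left half by u, then the right half minus u by v; the errors add. -/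
theorem coveringRadius_uuv_le {t n : ℕ} (C₁ C₂ : Submodule F (Fin n → F)) :
    coveringRadius t (uuv C₁ C₂) ≤ coveringRadius t C₁ + coveringRadius t C₂ := by
  refine coveringRadius_le fun w => ?_
  obtain ⟨u, hu, hu'⟩ :=
    exists_tWeight_le_coveringRadius C₁ (fun (i : Fin t) j => w i (Fin.castAdd n j))
  obtain ⟨v, hv, hv'⟩ := exists_tWeight_le_coveringRadius C₂
    (fun (i : Fin t) j => w i (Fin.natAdd n j) - u i j)
  refine ⟨fun i => Fin.append (u i) (u i + v i),
    fun i => ⟨u i, hu i, v i, hv i, rfl⟩, ?_⟩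
  refine le_trans (le_of_eq ?_) (add_le_add hu' hv')
  refine (tWeight_sub _ _).trans
    (.trans ?_ (congrArg₂ (· + ·) (tWeight_sub _ _) (tWeight_sub _ _)).symm)
  simp only [Fin.sum_univ_add, Fin.append_left, Fin.append_right, Pi.add_apply]
  congr 1
  refine Finset.sum_congr rfl fun j _ => ?_
  have h : ∀ i, u i j + v i j - w i (Fin.natAdd n j) =
      v i j - (w i (Fin.natAdd n j) - u i j) := fun i => by ring
  simp only [h]

theorem coveringRadius_comap_finCongr {t n n' : ℕ} (h : n = n') (C : Submodule F (Fin n → F)) :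
    coveringRadius t (C.comap (LinearEquiv.funCongrLeft F F (finCongr h)).toLinearMap) =
      coveringRadius t C := by
  subst h
  congr 1

end Weight

/-! ### Strength (orthogonal-array property) of codes -/

section Strength

variable {F : Type*} [Field F]

/-- `C` has strength `k`: its words take arbitrary values on any `k` coordinates. -/
def HasStrength {n : ℕ} (k : ℕ) (C : Submodule F (Fin n → F)) : Prop :=
  ∀ S : Finset (Fin n), S.card ≤ k → ∀ f : Fin n → F, ∃ c ∈ C, ∀ i ∈ S, c i = f i

theorem hasStrength_top (k n : ℕ) : HasStrength k (⊤ : Submodule F (Fin n → F)) :=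
  fun _ _ f => ⟨f, Submodule.mem_top, fun _ _ => rfl⟩

theorem HasStrength.comap_finCongr {n n' k : ℕ} (h : n = n') {C : Submodule F (Fin n → F)}
    (hC : HasStrength k C) :
    HasStrength k (C.comap (LinearEquiv.funCongrLeft F F (finCongr h)).toLinearMap) := by
  subst h
  exact hC

theorem hasStrength_repetitionCode (n : ℕ) : HasStrength 1 (repetitionCode n) := by
  intro S hS f
  have h2 : ∀ a : ZMod 2, a = 0 ∨ a = 1 := by decide
  rcases S.eq_empty_or_nonempty with rfl | ⟨i, hi⟩
  · exact ⟨0, zero_mem _, by simp⟩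
  have hi' : ∀ j ∈ S, j = i := fun j hj => Finset.card_le_one.1 hS j hj i hi
  rcases h2 (f i) with h | h
  · exact ⟨0, Or.inl rfl, fun j hj => by rw [hi' j hj, h]; rfl⟩
  · exact ⟨1, Or.inr rfl, fun j hj => by rw [hi' j hj, h]; rfl⟩

/-- One of the two halves contains at most k of the prescribed coordinates. A word of `C₁` settles
the other half, and a word of `C₂` corrects the small one. -/
theorem HasStrength.uuv {n k : ℕ} {C₁ C₂ : Submodule F (Fin n → F)} (hle : C₂ ≤ C₁)
    (h₁ : HasStrength (2 * k + 1) C₁) (h₂ : HasStrength k C₂) :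
    HasStrength (2 * k + 1) (uuv C₁ C₂) := by
  classical
  intro S hS f
  set S₁ := Finset.univ.filter fun j : Fin n => Fin.castAdd n j ∈ S
  set S₂ := Finset.univ.filter fun j : Fin n => Fin.natAdd n j ∈ S
  have hcard : S₁.card + S₂.card ≤ 2 * k + 1 := by
    refine le_trans (le_of_eq ?_) hS
    rw [show S = Finset.univ.filter (· ∈ S) by simp]
    simp only [S₁, S₂, Finset.card_filter, Fin.sum_univ_add]
  suffices h : ∃ u ∈ C₁, ∃ v ∈ C₂, (∀ j ∈ S₁, u j = f (Fin.castAdd n j)) ∧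
      ∀ j ∈ S₂, u j + v j = f (Fin.natAdd n j) by
    obtain ⟨u, hu, v, hv, hf₁, hf₂⟩ := h
    refine ⟨Fin.append u (u + v), ⟨u, hu, v, hv, rfl⟩, fun i => ?_⟩
    refine Fin.addCases (fun j hj => ?_) (fun j hj => ?_) i
    · rw [Fin.append_left]
      exact hf₁ j (by simpa [S₁] using hj)
    · rw [Fin.append_right]
      exact hf₂ j (Finset.mem_filter.2 ⟨Finset.mem_univ _, hj⟩)
  rcases (by omega : S₂.card ≤ k ∨ S₁.card ≤ k) with hk | hk
  · obtain ⟨u, hu, hu'⟩ := h₁ S₁ (by omega) fun j => f (Fin.castAdd n j)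
    obtain ⟨v, hv, hv'⟩ := h₂ S₂ hk fun j => f (Fin.natAdd n j) - u j
    exact ⟨u, hu, v, hv, hu', fun j hj => by rw [hv' j hj]; ring⟩
  -- Here w plays the role of u + v, so u = w - v lies in `C₁` only thanks to `hle`.
  · obtain ⟨w, hw, hw'⟩ := h₁ S₂ (by omega) fun j => f (Fin.natAdd n j)
    obtain ⟨v, hv, hv'⟩ := h₂ S₁ hk fun j => w j - f (Fin.castAdd n j)
    refine ⟨w - v, C₁.sub_mem hw (hle hv), v, hv, fun j hj => ?_, fun j hj => ?_⟩
    · rw [Pi.sub_apply, hv' j hj]; ring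
    · rw [Pi.sub_apply, hw' j hj |>.symm]; ring

end Strength

/-! ### Moments of the number of agreeing columns -/

section Moments

variable {F : Type*} [Field F] [Fintype F] [DecidableEq F] {t n : ℕ}

/-- The indicator that the `j`-th columns of `c` and `v` agree, minus the probability of this event
for a uniformly distributed column. -/
noncomputable def agreement (v c : Fin t → Fin n → F) (j : Fin n) : ℝ :=
  (if ∀ i, c i j = v i j then 1 else 0) - (Fintype.card (Fin t → F) : ℝ)⁻¹

/-- Strength k + 1 supplies translations by codeword tuples that vanish on `S` and have any
prescribed column a at j. They fix `h`, and exactly one a produces agreement at j, so averaging over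
a kills the sum. -/
theorem sum_agreement_mul_eq_zero {C : Submodule F (Fin n → F)} [Fintype C] {k : ℕ}
    (hC : HasStrength (k + 1) C) (v : Fin t → Fin n → F) {j : Fin n} {S : Finset (Fin n)}
    (hS : S.card ≤ k) (hj : j ∉ S) (h : (Fin t → C) → ℝ)
    (hh : ∀ c d : Fin t → C, (∀ i, ∀ l ∈ S, (d i : Fin n → F) l = 0) → h (c + d) = h c) :
    ∑ c : Fin t → C, agreement v (fun i => c i) j * h c = 0 := by
  classical
  have hd : ∀ a : F, ∃ d ∈ C, ∀ l ∈ insert j S, d l = if l = j then a else 0 := fun a =>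
    hC (insert j S) ((Finset.card_insert_le _ _).trans (by omega)) fun l => if l = j then a else 0
  choose d hdC hd using hd
  let D : (Fin t → F) → Fin t → C := fun a i => ⟨d (a i), hdC (a i)⟩
  have hDj : ∀ a i, (D a i : Fin n → F) j = a i := fun a i => by simp [D, hd]
  have hDS : ∀ a i, ∀ l ∈ S, (D a i : Fin n → F) l = 0 := fun a i l hl => by
    have hlj : l ≠ j := fun e => hj (e ▸ hl)
    simp [D, hd _ l (Finset.mem_insert_of_mem hl), hlj]
  have key : ∀ a, ∑ c : Fin t → C, agreement v (fun i => c i) j * h c =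
      ∑ c : Fin t → C, agreement v (fun i => (c + D a) i) j * h c := fun a =>
    (Fintype.sum_equiv (Equiv.addRight (D a)) _ _ fun c => by
      rw [Equiv.coe_addRight, hh c (D a) (hDS a)]).symm
  have hQ : (Fintype.card (Fin t → F) : ℝ) ≠ 0 := Nat.cast_ne_zero.2 Fintype.card_ne_zero
  have hsum : ∑ _a : Fin t → F, ∑ c : Fin t → C, agreement v (fun i => c i) j * h c = 0 := by
    rw [Finset.sum_congr rfl fun a _ => key a, Finset.sum_comm]
    refine Finset.sum_eq_zero fun c _ => ?_
    rw [← Finset.sum_mul]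
    refine mul_eq_zero_of_left ?_ _
    have hiff : ∀ a : Fin t → F, (∀ i, ((c + D a) i : Fin n → F) j = v i j) ↔
        a = fun i => v i j - (c i : Fin n → F) j := fun a => by
      rw [funext_iff]
      refine forall_congr' fun i => ?_
      rw [Pi.add_apply, Submodule.coe_add, Pi.add_apply, hDj, eq_sub_iff_add_eq']
    simp only [agreement, hiff, Finset.sum_sub_distrib, Finset.sum_ite_eq', Finset.mem_univ,
      if_true, Finset.sum_const, Finset.card_univ, nsmul_eq_mul]
    rw [mul_inv_cancel₀ hQ, sub_self]
  rw [Finset.sum_const, Finset.card_univ, nsmul_eq_mul] at hsum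
  exact (mul_eq_zero.1 hsum).resolve_left hQ

theorem agreement_add_eq {C : Submodule F (Fin n → F)} (v : Fin t → Fin n → F) {l : Fin n}
    (c d : Fin t → C) (hd : ∀ i, (d i : Fin n → F) l = 0) :
    agreement v (fun i => (c + d) i) l = agreement v (fun i => c i) l := by
  simp [agreement, hd]

/-- A variable with only the two values 1 - p and -p satisfies a quadratic equation; this reduces
second and third moments to the mean. -/
theorem agreement_sq {F : Type*} [Fintype F] [DecidableEq F] (v c : Fin t → Fin n → F) (j : Fin n) :
    agreement v c j * agreement v c j =
      (1 - 2 * (Fintype.card (Fin t → F) : ℝ)⁻¹) * agreement v c j +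
        (Fintype.card (Fin t → F) : ℝ)⁻¹ * (1 - (Fintype.card (Fin t → F) : ℝ)⁻¹) := by
  unfold agreement
  split_ifs <;> ring

section Code

variable {C : Submodule F (Fin n → F)} [Fintype C]

theorem sum_agreement (hC : HasStrength 3 C) (v : Fin t → Fin n → F) (j : Fin n) :
    ∑ c : Fin t → C, agreement v (fun i => c i) j = 0 := by
  simpa using sum_agreement_mul_eq_zero (k := 2) hC v (S := ∅) (by simp) (Finset.notMem_empty j)
    (fun _ => 1) (fun _ _ _ => rfl)

theorem sum_agreement_mul_of_ne (hC : HasStrength 3 C) (v : Fin t → Fin n → F) {j k l : Fin n}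
    (hk : j ≠ k) (hl : j ≠ l) :
    ∑ c : Fin t → C, agreement v (fun i => c i) j *
      (agreement v (fun i => c i) k * agreement v (fun i => c i) l) = 0 := by
  refine sum_agreement_mul_eq_zero (k := 2) hC v (S := {k, l}) Finset.card_le_two
    (by simp [hk, hl]) _ fun c d hd => ?_
  rw [agreement_add_eq v c d fun i => hd i k (by simp),
    agreement_add_eq v c d fun i => hd i l (by simp)]

theorem sum_agreement_mul (hC : HasStrength 3 C) (v : Fin t → Fin n → F) (j k : Fin n) :
    ∑ c : Fin t → C, agreement v (fun i => c i) j * agreement v (fun i => c i) k =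
      if j = k then (Fintype.card (Fin t → C) : ℝ) * ((Fintype.card (Fin t → F) : ℝ)⁻¹ *
        (1 - (Fintype.card (Fin t → F) : ℝ)⁻¹)) else 0 := by
  split_ifs with h
  · subst h
    simp only [agreement_sq, Finset.sum_add_distrib, ← Finset.mul_sum, sum_agreement hC]
    rw [mul_zero, zero_add, Finset.sum_const, Finset.card_univ, nsmul_eq_mul]
    ring
  · refine sum_agreement_mul_eq_zero (k := 2) hC v (S := {k}) (by simp) (by simpa using h) _
      fun c d hd => ?_
    rw [agreement_add_eq v c d fun i => hd i k (by simp)]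

/-- If some index differs from the other two, the sum vanishes. Otherwise it is a Bernoulli third
central moment, a nonnegative multiple of p(1 - p)(1 - 2p). -/
theorem sum_agreement_mul_mul_nonneg (hC : HasStrength 3 C) (v : Fin t → Fin n → F)
    (j k l : Fin n) :
    0 ≤ ∑ c : Fin t → C, agreement v (fun i => c i) j *
      (agreement v (fun i => c i) k * agreement v (fun i => c i) l) := by
  by_cases hjk : j = k
  · subst hjk
    by_cases hjl : j = l
    · subst hjl
      have hsq := sum_agreement_mul hC v j j
      rw [if_pos rfl] at hsq
      have h3 : ∀ c : Fin t → Fin n → F,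
          agreement v c j * (agreement v c j * agreement v c j) =
          (1 - 2 * (Fintype.card (Fin t → F) : ℝ)⁻¹) * (agreement v c j * agreement v c j) +
          (Fintype.card (Fin t → F) : ℝ)⁻¹ * (1 - (Fintype.card (Fin t → F) : ℝ)⁻¹) *
            agreement v c j := fun c => by
        conv_lhs => rw [agreement_sq]
        ring
      simp only [h3, Finset.sum_add_distrib, ← Finset.mul_sum, sum_agreement hC, hsq]
      have hQ : 0 < Fintype.card (Fin t → F) := Fintype.card_pos
      generalize Fintype.card (Fin t → F) = Q at hQ ⊢
      generalize Fintype.card (Fin t → C) = K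
      -- With p = 1/Q, the factor 1 - 2p is negative only for Q = 1, where 1 - p = 0.
      obtain rfl | h2 : Q = 1 ∨ 2 ≤ Q := by omega
      · simp
      · have hq : (Q : ℝ)⁻¹ ≤ 2⁻¹ := inv_anti₀ (by norm_num) (by exact_mod_cast h2)
        have hq0 : 0 ≤ (Q : ℝ)⁻¹ := by positivity
        rw [mul_zero, add_zero]
        exact mul_nonneg (by linarith) (mul_nonneg (by positivity)
          (mul_nonneg hq0 (by linarith)))
    · refine le_of_eq ?_
      rw [← sum_agreement_mul_of_ne hC v (Ne.symm hjl) (Ne.symm hjl)]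
      exact Finset.sum_congr rfl fun c _ => by ring
  · by_cases hjl : j = l
    · subst hjl
      refine le_of_eq ?_
      rw [← sum_agreement_mul_of_ne hC v (Ne.symm hjk) (Ne.symm hjk)]
      exact Finset.sum_congr rfl fun c _ => by ring
    · exact (sum_agreement_mul_of_ne hC v hjk hjl).ge

end Code

/-- A random variable with mean zero, variance `s ^ 2` and nonnegative third moment attains a value
at least `s`. -/
theorem exists_le_of_moments {ι : Type*} [Fintype ι] [Nonempty ι] (X : ι → ℝ) {s : ℝ} (hs : 0 ≤ s)
    (h₁ : ∑ i, X i = 0) (h₂ : ∑ i, X i ^ 2 = Fintype.card ι * s ^ 2) (h₃ : 0 ≤ ∑ i, X i ^ 3) :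
    ∃ i, s ≤ X i := by
  by_contra! hlt
  -- This cubic is chosen so that, after summing, the terms of degree at most two cancel. The third
  -- moment then forces X = -s everywhere, contradicting mean zero.
  have hnonneg : ∀ i ∈ Finset.univ, 0 ≤ (X i + s) ^ 2 * (s - X i) := fun i _ =>
    mul_nonneg (sq_nonneg _) (by linarith [hlt i])
  have hexp : ∑ i, (X i + s) ^ 2 * (s - X i) = -∑ i, X i ^ 3 := by
    have h : ∀ i, (X i + s) ^ 2 * (s - X i) =
        -(X i ^ 3) - s * X i ^ 2 + s ^ 2 * X i + s ^ 3 := fun i => by ring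
    simp only [h, Finset.sum_add_distrib, Finset.sum_sub_distrib, Finset.sum_neg_distrib,
      ← Finset.mul_sum, h₁, h₂, Finset.sum_const, Finset.card_univ, nsmul_eq_mul]
    ring
  have hzero : ∑ i, (X i + s) ^ 2 * (s - X i) = 0 :=
    le_antisymm (by linarith) (Finset.sum_nonneg hnonneg)
  have hX : ∀ i, X i = -s := fun i => by
    rcases mul_eq_zero.1 ((Finset.sum_eq_zero_iff_of_nonneg hnonneg).1 hzero i (Finset.mem_univ i))
      with h | h
    · linarith [pow_eq_zero_iff (two_ne_zero) |>.1 h]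
    · linarith [hlt i]
  simp only [hX, Finset.sum_const, Finset.card_univ, nsmul_eq_mul] at h₁
  have hK : (Fintype.card ι : ℝ) ≠ 0 := Nat.cast_ne_zero.2 Fintype.card_ne_zero
  have hs0 : -s = 0 := (mul_eq_zero.1 h₁).resolve_left hK
  obtain ⟨i⟩ := ‹Nonempty ι›
  linarith [hlt i, hX i]

theorem tWeight_sub_eq (v c : Matrix (Fin t) (Fin n) F) :
    (tWeight (c - v) : ℝ) =
      n * (1 - (Fintype.card (Fin t → F) : ℝ)⁻¹) - ∑ j, agreement v c j := by
  have h : ∀ j, ((if ∀ i, c i j - v i j = 0 then (0 : ℕ) else 1 : ℕ) : ℝ) =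
      (1 - (Fintype.card (Fin t → F) : ℝ)⁻¹) - agreement v c j := fun j => by
    simp only [agreement, sub_eq_zero]
    split_ifs <;> simp
  rw [tWeight_sub]
  simp only [Nat.cast_sum, h, Finset.sum_sub_distrib, Finset.sum_const,
    Finset.card_univ, Fintype.card_fin, nsmul_eq_mul]
  ring

theorem one_sub_inv_card_nonneg {F : Type*} [Field F] [Fintype F] : 0 ≤ 1 - (Fintype.card (Fin t → F) : ℝ)⁻¹ :=
  sub_nonneg.2 (inv_le_one_of_one_le₀ (by exact_mod_cast Fintype.card_pos))

theorem exists_sqrt_le_sum_agreement {C : Submodule F (Fin n → F)} [Fintype C]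
    (hC : HasStrength 3 C) (v : Fin t → Fin n → F) :
    ∃ c : Fin t → C, √(n * ((Fintype.card (Fin t → F) : ℝ)⁻¹ *
      (1 - (Fintype.card (Fin t → F) : ℝ)⁻¹))) ≤ ∑ j, agreement v (fun i => c i) j := by
  refine exists_le_of_moments (fun c : Fin t → C => ∑ j, agreement v (fun i => c i) j)
    (Real.sqrt_nonneg _) ?_ ?_ ?_
  · rw [Finset.sum_comm]
    exact Finset.sum_eq_zero fun j _ => sum_agreement hC v j
  · have hq := one_sub_inv_card_nonneg (F := F) (t := t)
    rw [Real.sq_sqrt (by positivity)]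
    simp only [pow_two, Finset.sum_mul_sum]
    rw [Finset.sum_comm, Finset.sum_congr rfl fun j _ => Finset.sum_comm]
    simp only [sum_agreement_mul hC, Finset.sum_ite_eq, Finset.mem_univ, if_true,
      Finset.sum_const, Finset.card_univ, Fintype.card_fin, nsmul_eq_mul]
    ring
  · have h : ∀ x : ℝ, x ^ 3 = x * (x * x) := fun x => by ring
    simp only [h, Finset.sum_mul_sum]
    simp only [Finset.mul_sum]
    rw [Finset.sum_comm]
    refine Finset.sum_nonneg fun j _ => ?_
    rw [Finset.sum_comm]
    refine Finset.sum_nonneg fun k _ => ?_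
    rw [Finset.sum_comm]
    exact Finset.sum_nonneg fun l _ => sum_agreement_mul_mul_nonneg hC v _ _ _

theorem exists_tWeight_le_of_hasStrength {C : Submodule F (Fin n → F)} (hC : HasStrength 3 C)
    (v : Matrix (Fin t) (Fin n) F) :
    ∃ c ∈ codePow t C, (tWeight (c - v) : ℝ) ≤
      n * (1 - (Fintype.card (Fin t → F) : ℝ)⁻¹) - √(n * ((Fintype.card (Fin t → F) : ℝ)⁻¹ *
        (1 - (Fintype.card (Fin t → F) : ℝ)⁻¹))) := by
  have : Fintype C := Fintype.ofFinite C
  obtain ⟨c, hc⟩ := exists_sqrt_le_sum_agreement hC v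
  exact ⟨fun i => c i, fun i => (c i).2, (tWeight_sub_eq v _).trans_le (sub_le_sub_left hc _)⟩

end Moments

/-! ### Reed–Muller codes: the cases r = 1 and r = m -/

section ReedMuller

theorem reedMuller_succ_succ {r m : ℕ} (h : r < m) :
    reedMuller (r + 1) (m + 1) = (uuv (reedMuller (r + 1) m) (reedMuller r m)).comap
      (LinearEquiv.funCongrLeft (ZMod 2) (ZMod 2)
        (finCongr (by rw [pow_succ, mul_two] : 2 ^ m + 2 ^ m = 2 ^ (m + 1)))).toLinearMap := by
  rw [reedMuller, if_neg (by omega)]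

theorem reedMuller_self {r : ℕ} (h : 1 ≤ r) : reedMuller r r = ⊤ := by
  obtain ⟨k, rfl⟩ := Nat.exists_eq_add_of_le' h
  rw [reedMuller, if_pos le_rfl]

theorem repetitionCode_le_reedMuller_one (m : ℕ) : repetitionCode (2 ^ m) ≤ reedMuller 1 m := by
  have h1 : (1 : Fin (2 ^ m) → ZMod 2) ∈ reedMuller 1 m := by
    induction m with
    | zero => simp [reedMuller]
    | succ m ih =>
      rcases Nat.eq_zero_or_pos m with rfl | hm
      · simp [reedMuller]
      · rw [reedMuller_succ_succ hm]
        refine ⟨1, ih, 0, zero_mem _, ?_⟩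
        ext i
        refine Fin.addCases (fun j => ?_) (fun j => ?_) i
        · rw [Fin.append_left]; rfl
        · rw [Fin.append_right, add_zero]; rfl
  rintro w (rfl | rfl)
  · exact zero_mem _
  · exact h1

theorem hasStrength_reedMuller_one (m : ℕ) : HasStrength 3 (reedMuller 1 m) := by
  induction m with
  | zero => rw [reedMuller]; exact hasStrength_top _ _
  | succ m ih =>
    rcases Nat.eq_zero_or_pos m with rfl | hm
    · rw [reedMuller_self le_rfl]; exact hasStrength_top _ _
    · rw [reedMuller_succ_succ hm]
      refine HasStrength.comap_finCongr _ ?_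
      rw [reedMuller]
      exact ih.uuv (k := 1) (repetitionCode_le_reedMuller_one m) (hasStrength_repetitionCode _)

theorem coveringRadius_reedMuller_one_le_sqrt (t m : ℕ) :
    (coveringRadius t (reedMuller 1 m) : ℝ) ≤
      (1 - 1 / 2 ^ t) * 2 ^ m - √(2 ^ t - 1) / 2 ^ t * √(2 ^ m) := by
  have hroot : √(((2 ^ m : ℕ) : ℝ) * ((Fintype.card (Fin t → ZMod 2) : ℝ)⁻¹ *
        (1 - (Fintype.card (Fin t → ZMod 2) : ℝ)⁻¹))) = √(2 ^ t - 1) / 2 ^ t * √(2 ^ m) := by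
    have h2 : ((Fintype.card (Fin t → ZMod 2) : ℕ) : ℝ) = 2 ^ t := by simp [ZMod.card]
    rw [h2]
    have hp : (0 : ℝ) < 2 ^ t := by positivity
    have h : ((2 ^ m : ℕ) : ℝ) * (((2 : ℝ) ^ t)⁻¹ * (1 - ((2 : ℝ) ^ t)⁻¹)) =
        (2 ^ t - 1) / (2 ^ t) ^ 2 * 2 ^ m := by
      push_cast
      field_simp
    rw [h, Real.sqrt_mul' _ (by positivity), Real.sqrt_div' _ (by positivity),
      Real.sqrt_sq hp.le]
  have h2 : ((Fintype.card (Fin t → ZMod 2) : ℕ) : ℝ) = 2 ^ t := by simp [ZMod.card]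
  have hB : ∀ v : Matrix (Fin t) (Fin (2 ^ m)) (ZMod 2), ∃ c ∈ codePow t (reedMuller 1 m),
      (tWeight (c - v) : ℝ) ≤ (1 - 1 / 2 ^ t) * 2 ^ m - √(2 ^ t - 1) / 2 ^ t * √(2 ^ m) :=
    fun v => by
      obtain ⟨c, hc, hle⟩ := exists_tWeight_le_of_hasStrength (hasStrength_reedMuller_one m) v
      refine ⟨c, hc, hle.trans (le_of_eq ?_)⟩
      rw [hroot, h2]
      push_cast
      ring
  set B := (1 - 1 / 2 ^ t) * 2 ^ m - √(2 ^ t - 1) / 2 ^ t * √((2 : ℝ) ^ m)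
  have hB0 : 0 ≤ B := by
    obtain ⟨c, -, hc⟩ := hB 0
    exact (Nat.cast_nonneg _).trans hc
  refine le_trans (Nat.cast_le.2 (coveringRadius_le (ρ := ⌊B⌋₊) fun v => ?_)) (Nat.floor_le hB0)
  obtain ⟨c, hc, hle⟩ := hB v
  exact ⟨c, hc, Nat.le_floor hle⟩

theorem sq_le_two_pow {m : ℕ} (hm : m ≠ 3) : m ^ 2 ≤ 2 ^ m := by
  obtain h | h : m < 4 ∨ 4 ≤ m := lt_or_ge m 4
  · interval_cases m <;> simp_all
  · induction m, h using Nat.le_induction with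
    | base => norm_num
    | succ k hk ih =>
      have := ih (by omega)
      rw [pow_succ 2 k]
      nlinarith

/-- Since √8 < 3, the moment bound falls just short; rounding it down to an integer recovers the
claim. -/
theorem coveringRadius_reedMuller_one_three_le (t : ℕ) :
    (coveringRadius t (reedMuller 1 3) : ℝ) ≤
      (1 - 1 / 2 ^ t) * 2 ^ 3 - √(2 ^ t - 1) / 2 ^ t * 3 := by
  have h := coveringRadius_reedMuller_one_le_sqrt t 3
  generalize coveringRadius t (reedMuller 1 3) = R at h ⊢
  have h8 : (2.8 : ℝ) ≤ √(2 ^ 3) := Real.le_sqrt_of_sq_le (by norm_num)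
  have hpos : 0 ≤ √((2 : ℝ) ^ t - 1) / 2 ^ t := by positivity
  have h' : (R : ℝ) ≤ (1 - 1 / 2 ^ t) * 2 ^ 3 - √(2 ^ t - 1) / 2 ^ t * 2.8 :=
    h.trans (sub_le_sub_left (mul_le_mul_of_nonneg_left h8 hpos) _)
  have hint : ∀ k : ℕ, (R : ℝ) < k + 1 → (R : ℝ) ≤ k := fun k hk => by
    have : R < k + 1 := by exact_mod_cast hk
    exact_mod_cast Nat.lt_succ_iff.1 this
  clear h
  obtain ht | ht : t < 5 ∨ 5 ≤ t := lt_or_ge t 5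
  · interval_cases t
    · norm_num at h' ⊢
      exact h'
    · norm_num at h' ⊢
      have := hint 2 (by push_cast; linarith)
      push_cast at this
      linarith
    · norm_num at h' ⊢
      have hlo : (1.7 : ℝ) ≤ √3 := Real.le_sqrt_of_sq_le (by norm_num)
      have hup : √3 ≤ 2 := Real.sqrt_le_iff.2 (by norm_num)
      have := hint 4 (by push_cast; linarith)
      push_cast at this
      linarith
    · norm_num at h' ⊢
      have hlo : (2 : ℝ) ≤ √7 := Real.le_sqrt_of_sq_le (by norm_num)
      have hup : √7 ≤ 8 / 3 := Real.sqrt_le_iff.2 (by norm_num)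
      have := hint 6 (by push_cast; linarith)
      push_cast at this
      linarith
    · norm_num at h' ⊢
      have hlo : (3.5 : ℝ) ≤ √15 := Real.le_sqrt_of_sq_le (by norm_num)
      have hup : √15 ≤ 4 := Real.sqrt_le_iff.2 (by norm_num)
      have := hint 6 (by push_cast; linarith)
      push_cast at this
      linarith
  · have h32 : (32 : ℝ) ≤ 2 ^ t := by
      calc (32 : ℝ) = 2 ^ 5 := by norm_num
        _ ≤ 2 ^ t := pow_le_pow_right₀ (by norm_num) ht
    have hy : (5 : ℝ) ≤ √(2 ^ t - 1) := Real.le_sqrt_of_sq_le (by linarith)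
    have hy2 : √((2 : ℝ) ^ t - 1) ^ 2 = 2 ^ t - 1 := Real.sq_sqrt (by linarith)
    have hR : (R : ℝ) ≤ 7 := by
      have hp : (0 : ℝ) < 1 / 2 ^ t := by positivity
      have := hint 7 (by push_cast; linarith)
      exact_mod_cast this
    refine hR.trans ?_
    have hp : (0 : ℝ) < 2 ^ t := by linarith
    have e : (1 - 1 / (2 : ℝ) ^ t) * 2 ^ 3 - √(2 ^ t - 1) / 2 ^ t * 3 =
        8 - (8 + 3 * √(2 ^ t - 1)) / 2 ^ t := by ring
    -- With y = √(2^t - 1) this is 8 + 3y ≤ y² + 1, valid for y ≥ 5.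
    have : (8 + 3 * √((2 : ℝ) ^ t - 1)) / 2 ^ t ≤ 1 := (div_le_one hp).2 (by nlinarith)
    linarith

theorem coveringRadius_reedMuller_one_le (t m : ℕ) :
    (coveringRadius t (reedMuller 1 m) : ℝ) ≤
      (1 - 1 / 2 ^ t) * 2 ^ m - √(2 ^ t - 1) / 2 ^ t * m := by
  by_cases hm : m = 3
  · subst hm
    exact_mod_cast coveringRadius_reedMuller_one_three_le t
  · refine (coveringRadius_reedMuller_one_le_sqrt t m).trans (sub_le_sub_left ?_ _)
    refine mul_le_mul_of_nonneg_left (Real.le_sqrt_of_sq_le ?_) (by positivity)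
    exact_mod_cast sq_le_two_pow hm

theorem coveringRadius_reedMuller_self_le {m : ℕ} (t : ℕ) (hm : 1 ≤ m) :
    (coveringRadius t (reedMuller m m) : ℝ) ≤
      (1 - 1 / 2 ^ t) * 2 ^ m - √(2 ^ t - 1) / 2 ^ t := by
  rw [reedMuller_self hm, coveringRadius_top, Nat.cast_zero]
  have hp : (0 : ℝ) < 2 ^ t := by positivity
  have h1 : (1 : ℝ) ≤ 2 ^ t := one_le_pow₀ (by norm_num)
  have h2 : (2 : ℝ) ≤ 2 ^ m := by
    simpa using pow_le_pow_right₀ (by norm_num : (1 : ℝ) ≤ 2) hm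
  have hy : √((2 : ℝ) ^ t - 1) ≤ (2 ^ t - 1) * 2 ^ m := by
    rcases Nat.eq_zero_or_pos t with rfl | ht
    · simp
    · have h2t : (2 : ℝ) ≤ 2 ^ t := by
        simpa using pow_le_pow_right₀ (by norm_num : (1 : ℝ) ≤ 2) ht
      have hx : (2 : ℝ) ^ t - 1 ≤ (2 ^ t - 1) * 2 ^ m :=
        le_mul_of_one_le_right (by linarith) (by linarith)
      exact Real.sqrt_le_iff.2 ⟨by nlinarith, by nlinarith⟩
  have e : (1 - 1 / (2 : ℝ) ^ t) * 2 ^ m - √(2 ^ t - 1) / 2 ^ t =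
      ((2 ^ t - 1) * 2 ^ m - √(2 ^ t - 1)) / 2 ^ t := by
    field_simp
  rw [e]
  exact div_nonneg (by linarith) hp.le

end ReedMuller

end GenCovering

theorem mainTheorem10 (m t r : ℕ) (hr : 1 ≤ r) (hrm : r ≤ m) :
    (GenCovering.coveringRadius t (GenCovering.reedMuller r m) : ℝ) ≤
      (1 - 1 / 2 ^ t) * 2 ^ m - √(2 ^ t - 1) / 2 ^ t * (m.choose r : ℝ) := by
  induction m generalizing r with
  | zero => omega
  | succ m ih =>
    obtain ⟨k, rfl⟩ := Nat.exists_eq_add_of_le' hr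
    -- The case r = 1 cannot come from the recursion: for r = 0 the bound fails when t = 1 and m ≥
    -- 1.
    rcases Nat.eq_zero_or_pos k with rfl | hk
    · simpa using GenCovering.coveringRadius_reedMuller_one_le t (m + 1)
    rcases (by omega : k = m ∨ k < m) with rfl | hkm
    · simpa using GenCovering.coveringRadius_reedMuller_self_le t hr
    · rw [GenCovering.reedMuller_succ_succ hkm, GenCovering.coveringRadius_comap_finCongr]
      have h : (GenCovering.coveringRadius t (GenCovering.uuv (GenCovering.reedMuller (k + 1) m)
          (GenCovering.reedMuller k m)) : ℝ) ≤
          GenCovering.coveringRadius t (GenCovering.reedMuller (k + 1) m) +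
            GenCovering.coveringRadius t (GenCovering.reedMuller k m) := by
        exact_mod_cast GenCovering.coveringRadius_uuv_le _ _
      have h₁ := ih (k + 1) (by omega) (by omega)
      have h₂ := ih k hk hkm.le
      rw [Nat.choose_succ_succ, Nat.cast_add, pow_succ (2 : ℝ) m]
      linarith
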